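/- Let $\mathbb N=\{1,2,\dots\}$ and $k\in\mathbb N$. Let $[\mathbb N]^k$ be the set of $k$-element subsets $s=\{s(1)<\dots<s(k)\}$ of $\mathbb N$. A finite sequence $(s_j)_{j=1}^m$ in $[\mathbb N]^k$ is a \emph{plegma family} if $s_1(i)<\dots<s_m(i)$ for $1\le i\le k$ and $s_m(i)<s_1(i+1)$ for $1\le i<k$; a plegma family with $m=2$ is a \emph{plegma pair}. A \emph{$k$-sequence} in a real Banach space $X$ is a family $(x_s)_{s\in[\mathbb N]^k}$ in $X$. It is \emph{weakly relatively compact} if the weak closure of $\{x_s:s\in[\mathbb N]^k\}$ is weakly compact. It \emph{generates $(e_n)_n$ as a $k$-spreading model}, where $(e_n)_{n}$ is a Hamel basis of a seminormed space $(E,\|\cdot\|_*)$, if there is a null sequence $(\delta_n)_n$ of positive reals such that $$\Big|\,\Big\|\sum_{j=1}^m a_jx_{s_j}\Big\|-\Big\|\sum_{j=1}^m a_je_j\Big\|_*\Big|\le\delta_l$$ for all $1\le m\le l$, all plegma families $(s_j)_{j=1}^m$ in $[\mathbb N]^k$ with $s_1(1)\ge l$ and all $a_1,\dots,a_m\in[-1,1]$.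 If $X$ has a fixed Schauder basis, a $k$-sequence $(x_s)_s$ is \emph{plegma block} if for every plegma pair $(s,t)$ the supports (with respect to the basis) of $x_s$ and $x_t$ are finite and $\operatorname{supp}(x_s)<\operatorname{supp}(x_t)$, that is, $m<n$ for all $m\in\operatorname{supp}(x_s)$ and $n\in\operatorname{supp}(x_t)$. The sequence $(e_n)_n$ is \emph{equivalent to the usual basis of $\ell^1$} if there are $0<c\le C$ with $c\|\sum_{i=1}^na_ie_i\|_*\le\sum_{i=1}^n|a_i|\le C\|\sum_{i=1}^na_ie_i\|_*$ for all $n$ and all real $a_1,\dots,a_n$. Theorem. Let $X$ be a real Banach space with a Schauder basis and let $k\in\mathbb N$. Suppose that some weakly relatively compact $k$-sequence in $X$ generates a $k$-spreading model equivalent to the usual basis of $\ell^1$. Then there is a plegma block $k$-sequence in $X$ that generates a $k$-spreading model equivalent to the usual basis of $\ell^1$. -/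

import Mathlib

/-- `KSet k` is `[ℕ]^k`: a `k`-element set of natural numbers, viewed as the strictly increasing
sequence of its elements. All sequences, sets and positions are indexed from `0` (so the positive
integer `n` is represented by `n - 1`): `s 0` is the least element of `s`. -/
abbrev KSet (k : ℕ) : Type := Fin k ↪o ℕ

/-- Plegma families `(s_j)_{j < m}` in `[ℕ]^k`. In view of the first clause, the second one says
that the `i`-th element of the last member is smaller than the `(i+1)`-st element of the first. -/
def IsPlegma {k m : ℕ} (s : Fin m → KSet k) : Prop :=
  (∀ (i : Fin k) (j j' : Fin m), j < j' → s j i < s j' i) ∧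
  (∀ i i' : Fin k, (i : ℕ) + 1 = (i' : ℕ) → ∀ j j' : Fin m, s j i < s j' i')

/-- The `k`-sequence `(x_s)_{s ∈ [ℕ]^k}` in `X` generates, as a `k`-spreading model with respect to
`δ`, the Hamel basis `e` of the linear space `E` seminormed by `p`. Because of the indexing from
`0`, the natural number `l` is the `(l+1)`-st element of the index set. -/
def GeneratesWith {X : Type*} [NormedAddCommGroup X] [NormedSpace ℝ X] {k : ℕ} [NeZero k]
    (x : KSet k → X) {E : Type*} [AddCommGroup E] [Module ℝ E]
    (p : Seminorm ℝ E) (e : Module.Basis ℕ ℝ E) (δ : ℕ → ℝ) : Prop :=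
  ∀ (m l : ℕ) [NeZero m], m ≤ l + 1 → ∀ s : Fin m → KSet k, IsPlegma s → l ≤ s 0 0 →
    ∀ a : Fin m → ℝ, (∀ j, a j ∈ Set.Icc (-1 : ℝ) 1) →
      |‖∑ j, a j • x (s j)‖ - p (∑ j, a j • e (j : ℕ))| ≤ δ l

/-- `(x_s)` generates `e` as a `k`-spreading model (with respect to some null sequence of positive
reals). -/
def GeneratesSpreadingModel {X : Type*} [NormedAddCommGroup X] [NormedSpace ℝ X] {k : ℕ} [NeZero k]
    (x : KSet k → X) {E : Type*} [AddCommGroup E] [Module ℝ E]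
    (p : Seminorm ℝ E) (e : Module.Basis ℕ ℝ E) : Prop :=
  ∃ δ : ℕ → ℝ, (∀ n, 0 < δ n) ∧ Filter.Tendsto δ Filter.atTop (nhds 0) ∧ GeneratesWith x p e δ

/-- The weak closure of `{x_s : s ∈ [ℕ]^k}` is weakly compact. -/
def WeaklyRelativelyCompact {X : Type*} [NormedAddCommGroup X] [NormedSpace ℝ X] {k : ℕ}
    (x : KSet k → X) : Prop :=
  IsCompact (closure (Set.range fun s => toWeakSpace ℝ X (x s)))

/-- The support of `x` with respect to the Schauder basis `b`. -/
def basisSupp {X : Type*} [NormedAddCommGroup X] [NormedSpace ℝ X] (b : SchauderBasis ℝ X)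
    (x : X) : Set ℕ :=
  {n | b.coord n x ≠ 0}

/-- `A < B` for finite sets of natural numbers: one of them is empty or `max A < min B`. -/
def FiniteSetLT (A B : Set ℕ) : Prop :=
  A.Finite ∧ B.Finite ∧ ∀ m ∈ A, ∀ n ∈ B, m < n

/-- Plegma block `k`-sequences: for every plegma pair `(s, t)`, `supp x_s < supp x_t`. -/
def PlegmaBlock {X : Type*} [NormedAddCommGroup X] [NormedSpace ℝ X] (b : SchauderBasis ℝ X)
    {k : ℕ} (x : KSet k → X) : Prop :=
  ∀ s t : KSet k, IsPlegma ![s, t] → FiniteSetLT (basisSupp b (x s)) (basisSupp b (x t))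

/-- Equivalence of two sequences in seminormed linear spaces. -/
def EquivalentSeq {E F : Type*} [AddCommGroup E] [Module ℝ E] [AddCommGroup F] [Module ℝ F]
    (p : Seminorm ℝ E) (e : ℕ → E) (q : Seminorm ℝ F) (f : ℕ → F) : Prop :=
  ∃ c C : ℝ, 0 < c ∧ c ≤ C ∧ ∀ (n : ℕ) (a : Fin n → ℝ),
    c * p (∑ i, a i • e (i : ℕ)) ≤ q (∑ i, a i • f (i : ℕ)) ∧
    q (∑ i, a i • f (i : ℕ)) ≤ C * p (∑ i, a i • e (i : ℕ))

/-- The sequence `e`, in the space seminormed by `p`, is equivalent to the usual basis of `ℓ¹`. -/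
def EquivalentToEllOneBasis {E : Type*} [AddCommGroup E] [Module ℝ E]
    (p : Seminorm ℝ E) (e : ℕ → E) : Prop :=
  EquivalentSeq p e (normSeminorm ℝ (lp (fun _ : ℕ => ℝ) 1))
    (fun n => lp.single 1 n (1 : ℝ))

/-! Fix a nonprincipal ultrafilter on `ℕ`. Weak compactness extends `x` to a tree `ψ` on finite
lists: `ψ t` is the weak limit of `ψ (t ++ [n])`, and the branch `s` ends in `x s`. Telescoping
along the branch writes `x s` as the root `ψ []` plus `k` level differences `nodeDiff ψ i`, each
weakly null in its last index.

Along a subsequence `M` every level difference generates a spreading model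
(`exists_strictMono_nodeDiff_asymptotic`, `exists_seminorm_generatesWith`). By weak nullness and
Mazur's theorem this model is suppression unconditional (`eventually_norm_suppressed_le`), so it
either dominates `ℓ¹` or has Cesàro means tending to `0` (`ellOne_lower_bound_or_cesaro`). If all
`k` levels were of the second kind, the combination with `n` coefficients `1` followed by `n`
coefficients `-1` would cancel the root and have too small a norm, against the lower `ℓ¹`-estimate
for `x`. So some level `i` carries `ℓ¹` (`exists_nodeDiff_ellOne`).

The level-`i` difference is determined by the first `i + 1` entries of `s` and is weakly null in the
last of these. Making `M` sparse at the same time, a sliding hump argument replaces it by a block,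
with an error too small to affect the spreading model (`GeneratesWith.perturb`). -/

open Filter Topology

/-! ### Dichotomy for spreading, suppression unconditional sequences. -/

section EllOneSeminorm

variable {E : Type*} [AddCommGroup E] [Module ℝ E]

/-- Setting coefficients to zero does not increase a seminorm, if this holds one coefficient at a
time. -/
theorem seminorm_sum_zeroed_le (q : Seminorm ℝ E) {m : ℕ} (v : Fin m → E)
    (hq : ∀ (a : Fin m → ℝ) (j₀ : Fin m),
      q (∑ j, Function.update a j₀ 0 j • v j) ≤ q (∑ j, a j • v j))
    (A : Finset (Fin m)) (a : Fin m → ℝ) :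
    q (∑ j, (if j ∈ A then 0 else a j) • v j) ≤ q (∑ j, a j • v j) := by
  classical
  induction A using Finset.induction_on with
  | empty => simp
  | insert i A hi ih =>
    refine le_trans (le_of_eq ?_) ((hq _ i).trans ih)
    congr 1
    refine Finset.sum_congr rfl fun j _ => ?_
    by_cases h : j = i
    · subst h; simp
    · simp [h]

/-- A spreading and suppression unconditional sequence is either bounded below by the usual basis
of `ℓ¹`, or has Cesàro means converging to `0`. -/
theorem ellOne_lower_bound_or_cesaro (q : Seminorm ℝ E) (e : ℕ → E)
    (hspread : ∀ (m : ℕ) (a : Fin m → ℝ) (σ : Fin m → ℕ), StrictMono σ →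
      q (∑ j, a j • e (σ j)) = q (∑ j, a j • e (j : ℕ)))
    (hsupp : ∀ (m : ℕ) (a : Fin m → ℝ) (j₀ : Fin m),
      q (∑ j, Function.update a j₀ 0 j • e (j : ℕ)) ≤ q (∑ j, a j • e (j : ℕ))) :
    (∃ c > 0, ∀ (m : ℕ) (a : Fin m → ℝ), c * ∑ j, |a j| ≤ q (∑ j, a j • e (j : ℕ))) ∨
      ∀ ε > 0, ∃ N, ∀ n ≥ N, q (∑ j ∈ Finset.range n, e j) ≤ ε * n := by
  classical
  by_contra! hcon
  obtain ⟨h1, ε, hε, h2⟩ := hcon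
  have he : ∀ j, q (e j) = q (e 0) := fun j => by
    have := hspread 1 (fun _ => 1) (fun _ => j) (Subsingleton.strictMono _)
    simpa using this
  set K := q (e 0) + 1 with hK
  have hK0 : 0 < K := by have := apply_nonneg q (e 0); linarith
  -- Nonnegative coefficients: a functional norming a long sum `S` must be at least `ε / 2` on many
  -- `e j`, and spreading moves the coefficients onto those indices.
  have key : ∀ (m : ℕ) (a : Fin m → ℝ), (∀ j, 0 ≤ a j) →
      ε / 2 * ∑ j, a j ≤ q (∑ j, a j • e (j : ℕ)) := by
    intro m a ha
    -- Indices outside `A` contribute at most `ε * n / 2` to `f S > ε * n`, the others at most `K`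
    -- each; so `ε * n > 2 * K * m` leaves at least `m` indices in `A`.
    obtain ⟨n, hn, hqn⟩ := h2 (⌈2 * K * m / ε⌉₊ + 1)
    set S := ∑ j ∈ Finset.range n, e j with hS
    have hn' : 2 * K * m / ε < n := by
      have := Nat.le_ceil (2 * K * m / ε)
      have h3 : ((⌈2 * K * m / ε⌉₊ + 1 : ℕ) : ℝ) ≤ n := by exact_mod_cast hn
      push_cast at h3
      linarith
    have hn'' : 2 * K * m < ε * n := by
      rw [div_lt_iff₀ hε] at hn'; linarith
    obtain ⟨f, hfS, hf⟩ : ∃ f : E →ₗ[ℝ] ℝ, f S = q S ∧ ∀ x, f x ≤ q x := by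
      have hS0 : S ≠ 0 := by
        intro h
        rw [h, map_zero] at hqn
        have : 0 ≤ ε * (n : ℝ) := by positivity
        linarith
      obtain ⟨g, hg1, hg2⟩ := exists_extension_of_le_sublinear
        (LinearPMap.mkSpanSingleton S (q S) hS0) q
        (fun c hc x => by simp [map_smul_eq_mul, abs_of_pos hc])
        (fun x y => map_add_le_add q x y)
        (by
          rintro ⟨x, hx⟩
          obtain ⟨t, rfl⟩ := Submodule.mem_span_singleton.1 hx
          rw [LinearPMap.mkSpanSingleton'_apply]
          simp only [map_smul_eq_mul, smul_eq_mul, Real.norm_eq_abs]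
          exact mul_le_mul_of_nonneg_right (le_abs_self t) (apply_nonneg q S))
      refine ⟨g, ?_, hg2⟩
      exact (hg1 ⟨S, Submodule.mem_span_singleton_self S⟩).trans
        ((LinearPMap.mkSpanSingleton'_apply_self _ _ _ _))
    set A := (Finset.range n).filter (fun j => ε / 2 ≤ f (e j)) with hA
    have hAm : m ≤ A.card := by
      have h3 : f S ≤ ∑ j ∈ Finset.range n, ((if ε / 2 ≤ f (e j) then K else 0) + ε / 2) := by
        rw [hS, map_sum]
        refine Finset.sum_le_sum fun j _ => ?_
        split_ifs with h
        · have := (hf (e j)).trans_eq (he j)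
          linarith
        · linarith
      rw [Finset.sum_add_distrib, ← Finset.sum_filter, Finset.sum_const, Finset.sum_const,
        Finset.card_range, nsmul_eq_mul, nsmul_eq_mul, hfS, ← hA] at h3
      have h4 : K * m < K * A.card := by nlinarith
      exact_mod_cast (lt_of_mul_lt_mul_left h4 hK0.le).le
    obtain ⟨A', hA', hcard⟩ := Finset.exists_subset_card_eq hAm
    rw [← hspread m a (A'.orderEmbOfFin hcard) (A'.orderEmbOfFin hcard).strictMono]
    refine le_trans ?_ (hf _)
    rw [map_sum, Finset.mul_sum]
    refine Finset.sum_le_sum fun j _ => ?_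
    rw [map_smul, smul_eq_mul, mul_comm]
    refine mul_le_mul_of_nonneg_left ?_ (ha j)
    exact (Finset.mem_filter.1 (hA' (A'.orderEmbOfFin_mem hcard j))).2
  -- Signed coefficients: the positive and the negative part are suppressions of `a` and `-a`.
  -- Adding their two estimates with `ε / 2` costs a factor `2`, hence `ε / 4`.
  obtain ⟨m, a, ham⟩ := h1 (ε / 4) (by positivity)
  have hpos := key m (fun j => if a j ≤ 0 then 0 else a j)
    (fun j => by split_ifs <;> linarith)
  have hneg := key m (fun j => if 0 ≤ a j then 0 else - a j)
    (fun j => by split_ifs <;> linarith)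
  have hpos' := seminorm_sum_zeroed_le q (fun j : Fin m => e j) (hsupp m)
    (Finset.univ.filter fun j => a j ≤ 0) a
  have hneg' := seminorm_sum_zeroed_le q (fun j : Fin m => e j) (hsupp m)
    (Finset.univ.filter fun j => 0 ≤ a j) (-a)
  have hmm : q (∑ j, (-a) j • e (j : ℕ)) = q (∑ j, a j • e (j : ℕ)) := by
    simp [Finset.sum_neg_distrib]
  simp only [Finset.mem_filter, Finset.mem_univ, true_and, Pi.neg_apply] at hpos' hneg' hmm
  have hsum : ∑ j, |a j| = ∑ j, (if a j ≤ 0 then 0 else a j) +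
      ∑ j, (if 0 ≤ a j then 0 else - a j) := by
    rw [← Finset.sum_add_distrib]
    refine Finset.sum_congr rfl fun j _ => ?_
    rcases lt_trichotomy (a j) 0 with h | h | h
    · simp [abs_of_neg h, h.le, h.not_ge]
    · simp [h]
    · simp [abs_of_pos h, h.le, h.not_ge]
  rw [hsum] at ham
  linarith

end EllOneSeminorm

/-! ### Iterated ultrafilters and diagonalization. -/

/-- The `r`-th iterated power of a nonprincipal ultrafilter on `ℕ`, living on lists of
length `r`. -/
noncomputable def iterU : ℕ → Ultrafilter (List ℕ)
  | 0 => pure []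
  | r + 1 => (hyperfilter ℕ).bind fun n => (iterU r).map (n :: ·)

theorem eventually_iterU_zero {p : List ℕ → Prop} : (∀ᶠ L : List ℕ in iterU 0, p L) ↔ p [] := by
  simp [iterU]

theorem eventually_iterU_succ {r : ℕ} {p : List ℕ → Prop} :
    (∀ᶠ L : List ℕ in iterU (r + 1), p L) ↔ ∀ᶠ n in hyperfilter ℕ, ∀ᶠ L : List ℕ in iterU r, p (n :: L) :=
  Iff.rfl

theorem eventually_iterU_add {r s : ℕ} {p : List ℕ → Prop} :
    (∀ᶠ L : List ℕ in iterU (r + s), p L) ↔ ∀ᶠ A : List ℕ in iterU r, ∀ᶠ B : List ℕ in iterU s, p (A ++ B) := by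
  induction r generalizing p with
  | zero => simp [eventually_iterU_zero]
  | succ r ih =>
    rw [Nat.add_right_comm, eventually_iterU_succ, eventually_iterU_succ]
    simp only [ih, List.cons_append]

theorem eventually_length_iterU (r : ℕ) : ∀ᶠ L : List ℕ in iterU r, L.length = r := by
  induction r with
  | zero => exact eventually_iterU_zero.2 rfl
  | succ r ih =>
    rw [eventually_iterU_succ]
    exact Eventually.of_forall fun n => ih.mono fun L hL => by simp [hL]

/-- Finiteness lets one new index be good for all lists of earlier indices at once. -/
theorem finite_bounded_lists (B N : ℕ) :
    {t : List ℕ | (∀ x ∈ t, x < B) ∧ t.length ≤ N}.Finite := by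
  refine ((List.finite_length_le (Fin B) N).image (List.map Fin.val)).subset ?_
  rintro t ⟨h1, h2⟩
  refine ⟨t.pmap Fin.mk h1, by simpa using h2, ?_⟩
  simp [List.map_pmap]

/-- A strictly increasing sequence whose terms are successively chosen in sets depending on a bound
for the preceding terms. -/
theorem exists_strictMono_mem (S : ℕ → Set ℕ) (hS : ∀ B, ∃ x ∈ S B, B ≤ x) :
    ∃ M B : ℕ → ℕ, StrictMono M ∧ Monotone B ∧ (∀ n, n ≤ B n) ∧ (∀ j n, j < n → M j < B n) ∧
      ∀ n, M n ∈ S (B n) := by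
  choose f hf hfB using hS
  let B : ℕ → ℕ := fun n => Nat.rec 0 (fun _ b => f b + 1) n
  have hB : ∀ n, B (n + 1) = f (B n) + 1 := fun n => rfl
  have hBs : StrictMono B := strictMono_nat_of_lt_succ fun n => by
    rw [hB]; exact Nat.lt_succ_of_le (hfB _)
  have hM : ∀ j n, j < n → f (B j) < B n := fun j n h => by
    have := hBs.monotone (Nat.succ_le_of_lt h)
    rw [Nat.succ_eq_add_one, hB] at this
    omega
  exact ⟨fun n => f (B n), B, fun j n h => (hM j n h).trans_le (hfB _), hBs.monotone,
    fun _ => hBs.le_apply, hM, fun n => hf _⟩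

/-- Diagonalization: properties holding almost surely for iterated ultrafilters hold for all
increasing lists of elements of a suitable sequence. -/
theorem exists_strictMono_diagonal (S : ℕ → Set ℕ) (hS : ∀ B, ∀ᶠ x in hyperfilter ℕ, x ∈ S B)
    (R : ℕ → ℕ) (P : ℕ → List ℕ → Prop) (hP : ∀ l r, ∀ᶠ L : List ℕ in iterU r, P l L) :
    ∃ M B : ℕ → ℕ, StrictMono M ∧ Monotone B ∧ (∀ n, n ≤ B n) ∧ (∀ j n, j < n → M j < B n) ∧
      (∀ n, M n ∈ S (B n)) ∧
      ∀ (l : ℕ) (L : List ℕ), L.Pairwise (· < ·) → (∀ x ∈ L, l ≤ x) → L.length ≤ R l →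
        P l (L.map M) := by
  -- `T B` collects the next indices that preserve every almost sure statement about a head with
  -- entries below `B`. These are finitely many conditions, so `T B` belongs to the ultrafilter.
  let T : ℕ → Set ℕ := fun B => {x | x ∈ S B ∧ ∀ l ∈ Set.Iic B, ∀ r ∈ Set.Iic (R l),
    ∀ t ∈ {t : List ℕ | (∀ y ∈ t, y < B) ∧ t.length ≤ R l},
      (∀ᶠ L : List ℕ in iterU (r + 1), P l (t ++ L)) → ∀ᶠ L : List ℕ in iterU r, P l (t ++ x :: L)}
  obtain ⟨M, B, hM, hB, hnB, hMB, hMT⟩ := exists_strictMono_mem T (by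
    intro B
    have h1 : ∀ᶠ x in hyperfilter ℕ, x ∈ T B := by
      refine (hS B).and ?_
      refine (eventually_all_finite (Set.finite_Iic B)).2 fun l _ => ?_
      refine (eventually_all_finite (Set.finite_Iic (R l))).2 fun r _ => ?_
      refine (eventually_all_finite (finite_bounded_lists B (R l))).2 fun t _ => ?_
      by_cases h : ∀ᶠ L : List ℕ in iterU (r + 1), P l (t ++ L)
      · exact (eventually_iterU_succ.1 h).mono fun x hx _ => hx
      · exact Eventually.of_forall fun x hx => absurd hx h
    have h2 : ∀ᶠ x in hyperfilter ℕ, B ≤ x :=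
      Nat.hyperfilter_le_atTop (eventually_ge_atTop B)
    exact (h1.and h2).exists)
  refine ⟨M, B, hM, hB, hnB, hMB, fun n => (hMT n).1, fun l => ?_⟩
  -- Entries pass one by one from the random tail to the fixed head `t`.
  have key : ∀ (L t : List ℕ), (t ++ L).Pairwise (· < ·) → (∀ x ∈ t ++ L, l ≤ x) →
      (t ++ L).length ≤ R l → (∀ᶠ A : List ℕ in iterU L.length, P l (t.map M ++ A)) →
      P l ((t ++ L).map M) := by
    intro L
    induction L with
    | nil =>
      intro t _ _ _ h
      simpa [eventually_iterU_zero] using h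
    | cons x L ih =>
      intro t h1 h2 h3 h4
      have := ih (t ++ [x]) (by simpa using h1) (by simpa using h2) (by simpa using h3) (by
        have h5 := (hMT x).2 l ((h2 x (by simp)).trans (hnB x)) L.length
          (by simp at h3 ⊢; omega) (t.map M) ⟨?_, by simp at h3 ⊢; omega⟩ (by simpa using h4)
        · simpa using h5
        · intro y hy
          obtain ⟨z, hz, rfl⟩ := List.mem_map.1 hy
          refine hMB z x ?_
          exact (List.pairwise_append.1 h1).2.2 z hz x (by simp))
      simpa using this
  intro L h1 h2 h3
  exact key L [] (by simpa using h1) (by simpa using h2) (by simpa using h3)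
    (by simpa using hP l L.length)

/-! ### Weak limits and the tree of a weakly relatively compact family. -/

section WeakLimits

variable {X : Type*} [NormedAddCommGroup X] [NormedSpace ℝ X]

/-- Closed convex sets contain the weak limits of their sequences. -/
theorem mem_of_frequently_mem_of_weak_tendsto {ι : Type*} {U : Filter ι} {u : ι → X} {x : X}
    (hu : ∀ f : StrongDual ℝ X, Tendsto (fun n => f (u n)) U (𝓝 (f x))) {s : Set X}
    (hs : Convex ℝ s) (hs' : IsClosed s) (h : ∃ᶠ n in U, u n ∈ s) : x ∈ s := by
  by_contra hx
  obtain ⟨f, r, hf, hr⟩ := geometric_hahn_banach_closed_point hs hs' hx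
  refine h (((hu f).eventually (lt_mem_nhds hr)).mono fun n hn hns => ?_)
  exact lt_asymm hn (hf _ hns)

theorem exists_tendsto_ultrafilter_of_bounded {β : Type*} (V : Ultrafilter β) (f : β → ℝ) (C : ℝ)
    (hf : ∀ b, |f b| ≤ C) : ∃ r, Tendsto f V (𝓝 r) := by
  obtain ⟨r, -, hr⟩ := (isCompact_Icc (a := -C) (b := C)).ultrafilter_le_nhds' (V.map f)
    (Ultrafilter.mem_map.2 (Eventually.of_forall fun b => abs_le.1 (hf b)))
  exact ⟨r, hr⟩

/-- Adding a weakly null sequence does not asymptotically decrease norms. -/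
theorem eventually_norm_le_norm_add_weakly_null {ι β : Type*} (U : Ultrafilter ι)
    (V : Ultrafilter β) (v : β → X) (C : ℝ) (hv : ∀ b, ‖v b‖ ≤ C) (u : ι → X)
    (hu : ∀ f : StrongDual ℝ X, Tendsto (fun n => f (u n)) U (𝓝 0)) {ε : ℝ} (hε : 0 < ε) :
    ∀ᶠ n in U, ∀ᶠ b in V, ‖v b‖ ≤ ‖v b + u n‖ + ε := by
  obtain ⟨r, hr⟩ := exists_tendsto_ultrafilter_of_bounded V (fun b => ‖v b‖) C (by simpa using hv)
  -- The `w` with `lim ‖v b + w‖ ≤ r - ε / 2`, where `r = lim ‖v b‖`, form a closed convex set that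
  -- misses `0`; by Mazur a weakly null family is almost surely outside it.
  let s : Set X := {w | ∀ η > 0, ∀ᶠ b in V, ‖v b + w‖ ≤ r - ε / 2 + η}
  have hs : Convex ℝ s := by
    intro x hx y hy a b ha hb hab η hη
    filter_upwards [hx η hη, hy η hη] with i h1 h2
    have h3 : v i + (a • x + b • y) = a • (v i + x) + b • (v i + y) := by
      rw [smul_add, smul_add, add_add_add_comm, ← add_smul, hab, one_smul]
    rw [h3]
    refine (norm_add_le _ _).trans ?_
    rw [norm_smul, norm_smul, Real.norm_of_nonneg ha, Real.norm_of_nonneg hb]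
    calc a * ‖v i + x‖ + b * ‖v i + y‖ ≤ a * (r - ε / 2 + η) + b * (r - ε / 2 + η) := by gcongr
      _ = r - ε / 2 + η := by rw [← add_mul, hab, one_mul]
  have hs' : IsClosed s := by
    refine isClosed_of_closure_subset fun x hx η hη => ?_
    obtain ⟨y, hy, hxy⟩ := Metric.mem_closure_iff.1 hx (η / 2) (half_pos hη)
    filter_upwards [hy (η / 2) (half_pos hη)] with i hi
    have h3 : v i + x = (v i + y) + (x - y) := by abel
    rw [dist_eq_norm] at hxy
    rw [h3]
    linarith [norm_add_le (v i + y) (x - y)]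
  have h0 : (0 : X) ∉ s := by
    intro h
    have h1 := h (ε / 4) (by positivity)
    have h2 := hr.eventually (lt_mem_nhds (show r - ε / 4 < r by linarith))
    obtain ⟨i, h3, h4⟩ := (h1.and h2).exists
    rw [add_zero] at h3
    linarith
  have hns : ∀ᶠ n in U, u n ∉ s := by
    rw [← not_frequently]
    exact fun h => h0 (mem_of_frequently_mem_of_weak_tendsto (by simpa using hu) hs hs' h)
  filter_upwards [hns] with n hn
  simp only [s, Set.mem_ofPred_eq, not_forall] at hn
  obtain ⟨η, hη, hn⟩ := hn
  rw [← Ultrafilter.eventually_not] at hn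
  filter_upwards [hn, hr.eventually (gt_mem_nhds (show r < r + ε / 2 by linarith))] with b h1 h2
  linarith

/-- The tree of iterated weak limits of a weakly relatively compact `k`-sequence. -/
theorem exists_weak_limit_tree {k : ℕ} (x : KSet k → X) (hx : WeaklyRelativelyCompact x) (C : ℝ)
    (hC : ∀ s, ‖x s‖ ≤ C) :
    ∃ ψ : List ℕ → X, (∀ s : KSet k, ψ (List.ofFn s) = x s) ∧
      (∀ t : List ℕ, t.length < k → ∀ f : StrongDual ℝ X,
        Tendsto (fun n => f (ψ (t ++ [n]))) (hyperfilter ℕ) (𝓝 (f (ψ t)))) ∧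
      ∀ t, ‖ψ t‖ ≤ C := by
  classical
  let K : Set X := {y | toWeakSpace ℝ X y ∈ closure (Set.range fun s => toWeakSpace ℝ X (x s))}
  have hKC : ∀ y ∈ K, ‖y‖ ≤ C := by
    intro y hy
    have h1 := (convex_closedBall (0 : X) C).toWeakSpace_closure (𝕜 := ℝ)
    rw [Metric.isClosed_closedBall.closure_eq] at h1
    have h2 : toWeakSpace ℝ X y ∈ toWeakSpace ℝ X '' Metric.closedBall 0 C := by
      rw [h1]
      refine closure_mono ?_ hy
      rintro _ ⟨s, rfl⟩
      exact ⟨x s, by simpa using hC s, rfl⟩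
    obtain ⟨y', h3, h4⟩ := h2
    rw [← (toWeakSpace ℝ X).injective h4]
    simpa using h3
  have hlim : ∀ u : ℕ → X, ∃ y : X, (∀ n, u n ∈ K) → y ∈ K ∧ ∀ f : StrongDual ℝ X,
      Tendsto (fun n => f (u n)) (hyperfilter ℕ) (𝓝 (f y)) := by
    intro u
    by_cases hu : ∀ n, u n ∈ K
    · obtain ⟨y, hy, hle⟩ := hx.ultrafilter_le_nhds'
        ((hyperfilter ℕ).map fun n => toWeakSpace ℝ X (u n))
        (Ultrafilter.mem_map.2 (Eventually.of_forall hu))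
      obtain ⟨y, rfl⟩ := (toWeakSpace ℝ X).surjective y
      refine ⟨y, fun _ => ⟨hy, fun f => ?_⟩⟩
      have hf : Continuous fun y : WeakSpace ℝ X => f ((toWeakSpace ℝ X).symm y) :=
        WeakBilin.eval_continuous (topDualPairing ℝ X).flip f
      have hu' : Tendsto (fun n => toWeakSpace ℝ X (u n)) (hyperfilter ℕ)
        (𝓝 (toWeakSpace ℝ X y)) := hle
      simpa [Function.comp_def] using (hf.tendsto (toWeakSpace ℝ X y)).comp hu'
    · exact ⟨0, fun h => absurd h hu⟩
  choose wl hwl using hlim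
  let s₀ : KSet k := Fin.valOrderEmb k
  -- `d` is the number of levels between `t` and the leaves. Lists that are not increasing get the
  -- harmless value `x s₀`, which keeps every node in the weakly compact set `K`.
  let Φ : ℕ → List ℕ → X := fun d => Nat.rec
    (Function.extend (fun s : KSet k => List.ofFn s) x (fun _ => x s₀))
    (fun _ φ t => wl fun n => φ (t ++ [n])) d
  have hinj : Function.Injective (fun s : KSet k => List.ofFn s) := fun s t h =>
    DFunLike.coe_injective (List.ofFn_injective h)
  have hxK : ∀ s, x s ∈ K := fun s =>
    show toWeakSpace ℝ X (x s) ∈ closure _ from subset_closure ⟨s, rfl⟩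
  have hΦ : ∀ d t, Φ d t ∈ K := by
    intro d
    induction d with
    | zero =>
      intro t
      change Function.extend _ _ _ t ∈ K
      by_cases h : ∃ s : KSet k, List.ofFn s = t
      · obtain ⟨s, rfl⟩ := h
        have := hinj.extend_apply x (fun _ => x s₀) s
        rw [this]
        exact hxK s
      · rw [Function.extend_apply' _ _ _ h]
        exact hxK s₀
    | succ d ih => exact fun t => (hwl _ fun n => ih _).1
  refine ⟨fun t => Φ (k - t.length) t, fun s => ?_, fun t ht f => ?_, fun t => hKC _ (hΦ _ _)⟩
  · simp only [List.length_ofFn, Nat.sub_self]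
    exact hinj.extend_apply x (fun _ => x s₀) s
  · obtain ⟨d, hd⟩ : ∃ d, k - t.length = d + 1 := ⟨k - t.length - 1, by omega⟩
    have hd' : ∀ n, k - (t ++ [n]).length = d := fun n => by simp; omega
    simp only [hd, hd']
    exact (hwl _ fun n => hΦ d _).2 f

end WeakLimits

/-! ### From asymptotic norms to a spreading model. -/

section SpreadingSeminorm

variable {X : Type*} [NormedAddCommGroup X] [NormedSpace ℝ X]

/-- The norms of the linear combinations of a bounded family of `m`-tuples converge along an
ultrafilter, uniformly for coefficients in `[-1, 1]`. -/
theorem exists_uniform_limit_norm_sum {β : Type*} (V : Ultrafilter β) {m : ℕ}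
    (w : β → Fin m → X) (C : ℝ) (hw : ∀ b j, ‖w b j‖ ≤ C) :
    ∃ Q : (Fin m → ℝ) → ℝ, ∀ ε > 0, ∀ᶠ b in V, ∀ a : Fin m → ℝ,
      (∀ j, a j ∈ Set.Icc (-1 : ℝ) 1) → |‖∑ j, a j • w b j‖ - Q a| ≤ ε := by
  have hN : ∀ a : Fin m → ℝ, ∀ b, |‖∑ j, a j • w b j‖| ≤ ∑ j, |a j| * C := by
    intro a b
    rw [abs_of_nonneg (norm_nonneg _)]
    refine norm_sum_le_of_le _ fun j _ => ?_
    rw [norm_smul, Real.norm_eq_abs]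
    exact mul_le_mul_of_nonneg_left (hw b j) (abs_nonneg _)
  choose Q hQ using fun a : Fin m → ℝ => exists_tendsto_ultrafilter_of_bounded V _ _ (hN a)
  refine ⟨Q, fun ε hε => ?_⟩
  -- A Lipschitz constant in the coefficients, uniform in `b`; it reduces uniform convergence on the
  -- compact cube to a finite net. The `+ 1` keeps it positive.
  set D := m * |C| + 1 with hD
  have hD0 : 0 < D := by positivity
  have hlip : ∀ (a a' : Fin m → ℝ) b,
      |‖∑ j, a j • w b j‖ - ‖∑ j, a' j • w b j‖| ≤ D * dist a a' := by
    intro a a' b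
    refine (abs_norm_sub_norm_le _ _).trans ?_
    rw [← Finset.sum_sub_distrib]
    have : ∀ j ∈ Finset.univ, ‖a j • w b j - a' j • w b j‖ ≤ dist a a' * |C| := by
      intro j _
      rw [← sub_smul, norm_smul, ← dist_eq_norm]
      exact mul_le_mul (dist_le_pi_dist a a' j) ((hw b j).trans (le_abs_self C)) (norm_nonneg _)
        dist_nonneg
    refine (norm_sum_le_of_le _ this).trans ?_
    rw [Finset.sum_const, Finset.card_univ, Fintype.card_fin, nsmul_eq_mul, hD]
    nlinarith [dist_nonneg (x := a) (y := a')]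
  have hlipQ : ∀ a a' : Fin m → ℝ, |Q a - Q a'| ≤ D * dist a a' := fun a a' =>
    le_of_tendsto ((hQ a).sub (hQ a')).abs (Eventually.of_forall (hlip a a'))
  have hcpt : IsCompact {a : Fin m → ℝ | ∀ j, a j ∈ Set.Icc (-1 : ℝ) 1} := by
    have := isCompact_univ_pi fun _ : Fin m => isCompact_Icc (a := (-1 : ℝ)) (b := 1)
    simpa [Set.pi] using! this
  obtain ⟨F, -, hF, hcov⟩ := hcpt.finite_cover_balls (e := ε / (3 * D)) (by positivity)
  have hev : ∀ᶠ b in V, ∀ a ∈ F, |‖∑ j, a j • w b j‖ - Q a| ≤ ε / 3 := by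
    refine (eventually_all_finite hF).2 fun a _ => ?_
    refine ((Metric.tendsto_nhds.1 (hQ a)) (ε / 3) (by positivity)).mono fun b hb => ?_
    rw [Real.dist_eq] at hb
    exact hb.le
  filter_upwards [hev] with b hb a ha
  obtain ⟨a', ha', hd⟩ := Set.mem_iUnion₂.1 (hcov ha)
  rw [Metric.mem_ball] at hd
  have hd' : D * dist a a' ≤ ε / 3 := by
    calc D * dist a a' ≤ D * (ε / (3 * D)) := by gcongr
      _ = ε / 3 := by field_simp
  have h1 := abs_le.1 (hb a' ha')
  have h2 := abs_le.1 ((hlip a a' b).trans hd')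
  have h3 := abs_le.1 ((hlipQ a a').trans hd')
  rw [abs_le]
  constructor <;> linarith

/-- The standard plegma families: the sequence `n ↦ arithPlegma k l n` restricted to `{0, …, l}`. -/
def arithPlegma (k l n : ℕ) : KSet k :=
  OrderEmbedding.ofStrictMono (fun i : Fin k => ((i : ℕ) + 1) * (l + 1) + n) fun i j h => by
    have : (i : ℕ) + 1 < (j : ℕ) + 1 := by simpa using h
    have := Nat.mul_lt_mul_of_pos_right this (Nat.succ_pos l)
    simpa using this

theorem arithPlegma_apply (k l n : ℕ) (i : Fin k) :
    arithPlegma k l n i = ((i : ℕ) + 1) * (l + 1) + n := rfl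

theorem isPlegma_arithPlegma (k : ℕ) {l m : ℕ} (σ : Fin m → ℕ) (hσ : StrictMono σ)
    (hl : ∀ j, σ j ≤ l) : IsPlegma fun j => arithPlegma k l (σ j) := by
  refine ⟨fun i j j' h => ?_, fun i i' h j j' => ?_⟩
  · simpa [arithPlegma_apply] using hσ h
  · rw [arithPlegma_apply, arithPlegma_apply, ← h, add_mul ((i : ℕ) + 1) 1 (l + 1)]
    have := hl j
    omega

/-- A bounded `k`-sequence whose plegma families have asymptotically constant norms of linear
combinations generates a `k`-spreading model. -/
theorem exists_seminorm_generatesWith {k : ℕ} [NeZero k] (z : KSet k → X) (C : ℝ)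
    (hC : ∀ s, ‖z s‖ ≤ C) (Q : ∀ m : ℕ, (Fin m → ℝ) → ℝ) (δ : ℕ → ℝ)
    (hδ : Tendsto δ atTop (𝓝 0))
    (h : ∀ (m l : ℕ) [NeZero m], m ≤ l + 1 → ∀ s : Fin m → KSet k, IsPlegma s → l ≤ s 0 0 →
      ∀ a : Fin m → ℝ, (∀ j, a j ∈ Set.Icc (-1 : ℝ) 1) →
        |‖∑ j, a j • z (s j)‖ - Q m a| ≤ δ l) :
    ∃ q : Seminorm ℝ (ℕ →₀ ℝ),
      GeneratesWith z q (Finsupp.basisSingleOne : Module.Basis ℕ ℝ (ℕ →₀ ℝ)) δ ∧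
      ∀ (m : ℕ) [NeZero m] (σ : Fin m → ℕ), StrictMono σ → ∀ a : Fin m → ℝ,
        (∀ j, a j ∈ Set.Icc (-1 : ℝ) 1) →
        q (∑ j, a j • (Finsupp.basisSingleOne : Module.Basis ℕ ℝ (ℕ →₀ ℝ)) (σ j)) = Q m a := by
  -- The seminorm is the limit in `l` of `‖T l x‖`. For fixed indices and large `l` the vectors
  -- involved come from a plegma family starting beyond `l`, so the limit is `Q`.
  let T : ℕ → (ℕ →₀ ℝ) →ₗ[ℝ] X := fun l => Finsupp.linearCombination ℝ fun n => z (arithPlegma k l n)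
  have hT : ∀ x l, |‖T l x‖| ≤ ∑ n ∈ x.support, |x n| * C := by
    intro x l
    rw [abs_of_nonneg (norm_nonneg _), Finsupp.linearCombination_apply]
    refine norm_sum_le_of_le _ fun j _ => ?_
    rw [norm_smul, Real.norm_eq_abs]
    exact mul_le_mul_of_nonneg_left (hC _) (abs_nonneg _)
  choose q hq using fun x => exists_tendsto_ultrafilter_of_bounded (hyperfilter ℕ) _ _ (hT x)
  let q' : Seminorm ℝ (ℕ →₀ ℝ) := Seminorm.of q
    (fun x y => le_of_tendsto_of_tendsto (hq (x + y)) ((hq x).add (hq y))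
      (Eventually.of_forall fun l => by simpa only [map_add] using norm_add_le _ _))
    (fun c x => tendsto_nhds_unique (hq (c • x))
      (((hq x).const_mul ‖c‖).congr fun l => by simp [norm_smul]))
  have hq' : ∀ (m : ℕ) [NeZero m] (σ : Fin m → ℕ), StrictMono σ → ∀ a : Fin m → ℝ,
      (∀ j, a j ∈ Set.Icc (-1 : ℝ) 1) →
      q (∑ j, a j • (Finsupp.basisSingleOne : Module.Basis ℕ ℝ (ℕ →₀ ℝ)) (σ j)) = Q m a := by
    intro m _ σ hσ a ha
    refine tendsto_nhds_unique (hq _) ?_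
    rw [tendsto_iff_norm_sub_tendsto_zero]
    refine squeeze_zero' (Eventually.of_forall fun _ => norm_nonneg _) ?_
      (hδ.mono_left Nat.hyperfilter_le_atTop)
    have hev : ∀ᶠ l in atTop, m ≤ l + 1 ∧ ∀ j, σ j ≤ l := by
      refine ((eventually_ge_atTop m).mono fun l hl => by omega).and ?_
      exact eventually_all.2 fun j => eventually_ge_atTop _
    refine (hev.filter_mono Nat.hyperfilter_le_atTop).mono fun l hl => ?_
    rw [Real.norm_eq_abs]
    have := h m l hl.1 (fun j => arithPlegma k l (σ j)) (isPlegma_arithPlegma k σ hσ hl.2)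
      (by rw [arithPlegma_apply]; nlinarith [Nat.zero_le (σ 0)]) a ha
    simpa [T] using this
  refine ⟨q', ?_, hq'⟩
  intro m l _ hm s hs hl a ha
  have h1 := hq' m (fun j => (j : ℕ)) (fun i j hij => hij) a ha
  rw [show q' (∑ j, a j • (Finsupp.basisSingleOne : Module.Basis ℕ ℝ (ℕ →₀ ℝ)) (j : ℕ)) = Q m a
    from h1]
  exact h m l hm s hs hl a ha

end SpreadingSeminorm

/-! ### Index matrices, branches and level differences. -/

/-- The list of the first `i` values of `c`. -/
def initSeg (c : ℕ → ℕ) (i : ℕ) : List ℕ := (List.range i).map c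

theorem initSeg_succ (c : ℕ → ℕ) (i : ℕ) : initSeg c (i + 1) = initSeg c i ++ [c i] := by
  simp [initSeg, List.range_succ]

theorem length_initSeg (c : ℕ → ℕ) (i : ℕ) : (initSeg c i).length = i := by simp [initSeg]

theorem initSeg_congr {c c' : ℕ → ℕ} {i : ℕ} (h : ∀ r < i, c r = c' r) :
    initSeg c i = initSeg c' i :=
  List.map_congr_left fun r hr => h r (List.mem_range.1 hr)

/-- The `j`-th column of a matrix with rows of length `m`, listed row by row. -/
def listCol (m j : ℕ) (L : List ℕ) : ℕ → ℕ := fun i => L.getD (i * m + j) 0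

/-- A `k`-element set as a function on `ℕ`. -/
def KSet.extend {k : ℕ} (s : KSet k) : ℕ → ℕ := fun i => if h : i < k then s ⟨i, h⟩ else 0

theorem KSet.extend_apply {k : ℕ} (s : KSet k) {i : ℕ} (h : i < k) : s.extend i = s ⟨i, h⟩ :=
  dif_pos h

theorem initSeg_comp_extend {k : ℕ} (s : KSet k) {M : ℕ → ℕ} (hM : StrictMono M) :
    initSeg (fun i => M (s.extend i)) k = List.ofFn (s.trans (OrderEmbedding.ofStrictMono M hM)) := by
  refine List.ext_getElem (by simp [initSeg]) fun i h1 h2 => ?_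
  have hi : i < k := by simpa using h2
  simp [initSeg, s.extend_apply hi]

theorem getD_append_cons_of_ne (A B : List ℕ) (n n' : ℕ) {r : ℕ} (h : r ≠ A.length) :
    (A ++ n :: B).getD r 0 = (A ++ n' :: B).getD r 0 := by
  rcases lt_or_gt_of_ne h with h | h
  · rw [List.getD_append _ _ _ _ h, List.getD_append _ _ _ _ h]
  · rw [List.getD_append_right _ _ _ _ h.le, List.getD_append_right _ _ _ _ h.le]
    obtain ⟨d, hd⟩ : ∃ d, r - A.length = d + 1 := ⟨r - A.length - 1, by omega⟩
    rw [hd, List.getD_cons_succ, List.getD_cons_succ]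

section Suppression

variable {X : Type*} [NormedAddCommGroup X]

/-- The difference of the values of a tree at two consecutive nodes of a branch. -/
def nodeDiff (ψ : List ℕ → X) (i : ℕ) (c : ℕ → ℕ) : X := ψ (initSeg c (i + 1)) - ψ (initSeg c i)

theorem norm_nodeDiff_le {ψ : List ℕ → X} {C : ℝ} (hC : ∀ t, ‖ψ t‖ ≤ C) (i : ℕ) (c : ℕ → ℕ) :
    ‖nodeDiff ψ i c‖ ≤ 2 * C := by
  refine (norm_sub_le _ _).trans ?_
  linarith [hC (initSeg c (i + 1)), hC (initSeg c i)]

theorem nodeDiff_congr (ψ : List ℕ → X) {i : ℕ} {c c' : ℕ → ℕ} (h : ∀ r ≤ i, c r = c' r) :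
    nodeDiff ψ i c = nodeDiff ψ i c' := by
  rw [nodeDiff, nodeDiff, initSeg_congr (i := i + 1) fun r hr => h r (by omega),
    initSeg_congr (i := i) fun r hr => h r hr.le]

/-- Entries are drawn row by row. Entry `(i, j₀)` enters none of the other columns' level-`i`
differences, and it is the last index of the difference for `j₀`. Hence, given the earlier entries,
that summand is a weakly null perturbation of the rest. -/
theorem eventually_norm_suppressed_le [NormedSpace ℝ X] {k : ℕ} {ψ : List ℕ → X} {C : ℝ} (hC : ∀ t, ‖ψ t‖ ≤ C)
    (hψ : ∀ t : List ℕ, t.length < k → ∀ f : StrongDual ℝ X,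
      Tendsto (fun n => f (ψ (t ++ [n]))) (hyperfilter ℕ) (𝓝 (f (ψ t))))
    {i m : ℕ} (hi : i < k) (a : Fin m → ℝ) (j₀ : Fin m) {ε : ℝ} (hε : 0 < ε) :
    ∀ᶠ L : List ℕ in iterU (k * m),
      ‖∑ j, Function.update a j₀ 0 j • nodeDiff ψ i (listCol m j L)‖ ≤
        ‖∑ j, a j • nodeDiff ψ i (listCol m j L)‖ + ε := by
  obtain ⟨d, hd⟩ : ∃ d, k * m = (i * m + j₀) + (d + 1) := by
    have h1 : (i + 1) * m ≤ k * m := Nat.mul_le_mul_right m hi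
    have h2 := j₀.2
    refine ⟨k * m - (i * m + j₀) - 1, ?_⟩
    rw [add_mul, one_mul] at h1
    omega
  rw [hd, eventually_iterU_add]
  filter_upwards [eventually_length_iterU (i * m + j₀)] with A hA
  rw [eventually_iterU_succ]
  let v : List ℕ → X := fun B =>
    ∑ j, Function.update a j₀ 0 j • nodeDiff ψ i (listCol m j (A ++ 0 :: B))
  have hv : ∀ B, ‖v B‖ ≤ ∑ j, |Function.update a j₀ 0 j| * (2 * C) := fun B => by
    refine norm_sum_le_of_le _ fun j _ => ?_
    rw [norm_smul, Real.norm_eq_abs]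
    exact mul_le_mul_of_nonneg_left (norm_nodeDiff_le hC _ _) (abs_nonneg _)
  let t := initSeg (listCol m j₀ A) i
  let u : ℕ → X := fun n => a j₀ • (ψ (t ++ [n]) - ψ t)
  have hu : ∀ f : StrongDual ℝ X, Tendsto (fun n => f (u n)) (hyperfilter ℕ) (𝓝 0) := by
    intro f
    have := (((hψ t (by simpa [t, length_initSeg] using hi) f).sub_const (f (ψ t))).const_mul
      (a j₀))
    simpa [u] using this
  have hne : ∀ (j : Fin m), j ≠ j₀ → ∀ n B, nodeDiff ψ i (listCol m j (A ++ n :: B)) =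
      nodeDiff ψ i (listCol m j (A ++ 0 :: B)) := by
    intro j hj n B
    refine nodeDiff_congr ψ fun r hr => getD_append_cons_of_ne _ _ _ _ ?_
    rw [hA]
    have hj' : (j : ℕ) ≠ j₀ := fun h => hj (Fin.ext h)
    rcases hr.eq_or_lt with rfl | hr
    · omega
    · have h1 : (r + 1) * m ≤ i * m := Nat.mul_le_mul_right m hr
      rw [add_mul, one_mul] at h1
      have := j.2
      omega
  have hj₀ : ∀ n B, nodeDiff ψ i (listCol m j₀ (A ++ n :: B)) = ψ (t ++ [n]) - ψ t := by
    intro n B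
    have h1 : initSeg (listCol m j₀ (A ++ n :: B)) i = t := initSeg_congr fun r hr => by
      refine List.getD_append _ _ _ _ ?_
      rw [hA]
      have := Nat.mul_lt_mul_of_pos_right hr j₀.pos
      omega
    have h2 : listCol m j₀ (A ++ n :: B) i = n := by
      rw [listCol, ← hA, List.getD_append_right _ _ _ _ le_rfl]
      simp
    rw [nodeDiff, initSeg_succ, h1, h2]
  filter_upwards [eventually_norm_le_norm_add_weakly_null (hyperfilter ℕ) (iterU d) v _ hv u hu hε]
    with n hn
  filter_upwards [hn] with B hB
  have e1 : ∑ j, Function.update a j₀ 0 j • nodeDiff ψ i (listCol m j (A ++ n :: B)) = v B := by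
    refine Finset.sum_congr rfl fun j _ => ?_
    by_cases hj : j = j₀
    · subst hj; simp
    · rw [hne j hj]
  have e2 : ∑ j, a j • nodeDiff ψ i (listCol m j (A ++ n :: B)) = v B + u n := by
    rw [← e1, ← Finset.add_sum_erase _ _ (Finset.mem_univ j₀),
      ← Finset.add_sum_erase (a := j₀) _ (fun j => Function.update a j₀ 0 j • _)
        (Finset.mem_univ j₀), hj₀]
    simp only [Function.update_self, zero_smul, zero_add]
    rw [add_comm]
    congr 1
    refine Finset.sum_congr rfl fun j hj => ?_
    rw [Function.update_of_ne (Finset.ne_of_mem_erase hj)]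
  rw [e1, e2]
  exact hB

end Suppression

/-! ### Plegma families as increasing lists. -/

section Flatten

variable {k m : ℕ}

/-- The elements of the members of a plegma family in increasing order. -/
def flattenPlegma (s : Fin m → KSet k) : List ℕ :=
  List.ofFn fun r : Fin (k * m) => s r.modNat r.divNat

theorem length_flattenPlegma (s : Fin m → KSet k) : (flattenPlegma s).length = k * m := by
  simp [flattenPlegma]

/-- The first plegma clause orders each row; the second passes to the next row, and monotonicity of
a member to later ones. -/
theorem pairwise_flattenPlegma {s : Fin m → KSet k} (hs : IsPlegma s) :
    (flattenPlegma s).Pairwise (· < ·) := by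
  rw [flattenPlegma, List.pairwise_ofFn]
  intro r r' h
  have h1 : (r.divNat : ℕ) ≤ r'.divNat := by
    simpa using Nat.div_le_div_right (c := m) h.le
  rcases h1.eq_or_lt with h1 | h1
  · have h2 : r.modNat < r'.modNat := by
      have e1 := Nat.div_add_mod (r : ℕ) m
      have e2 := Nat.div_add_mod (r' : ℕ) m
      have h3 : (r : ℕ) / m = r' / m := by simpa using h1
      have h4 : (r : ℕ) < r' := h
      rw [h3] at e1
      rw [Fin.lt_def, Fin.coe_modNat, Fin.coe_modNat]
      omega
    rw [Fin.ext h1]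
    exact hs.1 _ _ _ h2
  · have h4 : (r.divNat : ℕ) + 1 < k := by have := r'.divNat.2; omega
    exact (hs.2 r.divNat ⟨_, h4⟩ rfl r.modNat r'.modNat).trans_le
      ((s r'.modNat).monotone (Fin.le_def.2 h1))

theorem IsPlegma.le_apply [NeZero k] [NeZero m] {s : Fin m → KSet k} (hs : IsPlegma s) (j : Fin m)
    (i : Fin k) : s 0 0 ≤ s j i := by
  refine le_trans ?_ ((s j).monotone (Fin.zero_le i))
  rcases (Fin.zero_le j).eq_or_lt with h | h
  · rw [← h]
  · exact (hs.1 0 _ _ h).le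

theorem le_of_mem_flattenPlegma [NeZero k] [NeZero m] {s : Fin m → KSet k} (hs : IsPlegma s) {l : ℕ}
    (hl : l ≤ s 0 0) : ∀ x ∈ flattenPlegma s, l ≤ x := by
  intro x hx
  obtain ⟨r, rfl⟩ := (List.mem_ofFn' _ _).1 hx
  exact hl.trans (hs.le_apply _ _)

theorem listCol_map_flattenPlegma (s : Fin m → KSet k) (M : ℕ → ℕ) (j : Fin m) {i : ℕ}
    (hi : i < k) : listCol m j ((flattenPlegma s).map M) i = M ((s j).extend i) := by
  have h1 : i * m + j < k * m := by
    have h1 : (i + 1) * m ≤ k * m := Nat.mul_le_mul_right m hi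
    rw [add_mul, one_mul] at h1
    have := j.2
    omega
  have h2 : (⟨i * m + j, h1⟩ : Fin (k * m)).divNat = ⟨i, hi⟩ := by
    refine Fin.ext ?_
    rw [Fin.coe_divNat]
    change (i * m + (j : ℕ)) / m = i
    rw [mul_comm, Nat.mul_add_div j.pos, Nat.div_eq_of_lt j.2, add_zero]
  have h3 : (⟨i * m + j, h1⟩ : Fin (k * m)).modNat = j := by
    refine Fin.ext ?_
    rw [Fin.coe_modNat]
    change (i * m + (j : ℕ)) % m = j
    rw [mul_comm, Nat.mul_add_mod, Nat.mod_eq_of_lt j.2]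
  rw [listCol, List.getD_eq_getElem _ _ (by simpa [flattenPlegma] using h1), (s j).extend_apply hi]
  simp [flattenPlegma, h2, h3]

end Flatten

theorem IsPlegma.map {k m : ℕ} {s : Fin m → KSet k} (hs : IsPlegma s) {M : ℕ → ℕ}
    (hM : StrictMono M) : IsPlegma fun j => (s j).trans (OrderEmbedding.ofStrictMono M hM) :=
  ⟨fun i j j' h => hM (hs.1 i j j' h), fun i i' h j j' => hM (hs.2 i i' h j j')⟩

/-! ### Spreading models of the level differences. -/

section TreeSpreadingModels

variable {X : Type*} [NormedAddCommGroup X] [NormedSpace ℝ X]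

/-- `Q` is the limit of norms along the iterated ultrafilter. Diagonalization applies to plegma
families since, listed row by row, they are increasing; suppression for `Q` comes from the almost
sure inequality. -/
theorem exists_strictMono_nodeDiff_asymptotic {k : ℕ} [NeZero k] {ψ : List ℕ → X} {C : ℝ}
    (hC : ∀ t, ‖ψ t‖ ≤ C)
    (hψ : ∀ t : List ℕ, t.length < k → ∀ f : StrongDual ℝ X,
      Tendsto (fun n => f (ψ (t ++ [n]))) (hyperfilter ℕ) (𝓝 (f (ψ t))))
    (S : ℕ → Set ℕ) (hS : ∀ B, ∀ᶠ x in hyperfilter ℕ, x ∈ S B) :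
    ∃ M B : ℕ → ℕ, StrictMono M ∧ Monotone B ∧ (∀ n, n ≤ B n) ∧ (∀ j n, j < n → M j < B n) ∧
      (∀ n, M n ∈ S (B n)) ∧ ∃ Q : ℕ → ∀ m : ℕ, (Fin m → ℝ) → ℝ,
        (∀ i < k, ∀ (m l : ℕ) [NeZero m], m ≤ l + 1 → ∀ s : Fin m → KSet k, IsPlegma s →
          l ≤ s 0 0 → ∀ a : Fin m → ℝ, (∀ j, a j ∈ Set.Icc (-1 : ℝ) 1) →
          |‖∑ j, a j • nodeDiff ψ i (fun r => M ((s j).extend r))‖ - Q i m a| ≤ 1 / ((l : ℝ) + 1)) ∧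
        ∀ i < k, ∀ (m : ℕ) (a : Fin m → ℝ) (j₀ : Fin m), (∀ j, a j ∈ Set.Icc (-1 : ℝ) 1) →
          Q i m (Function.update a j₀ 0) ≤ Q i m a := by
  choose Q hQ using fun i m => exists_uniform_limit_norm_sum (iterU (k * m))
    (fun L (j : Fin m) => nodeDiff ψ i (listCol m j L)) (2 * C)
    (fun L j => norm_nodeDiff_le hC _ _)
  let P : ℕ → List ℕ → Prop := fun l L => ∀ i ∈ Set.Iio k, ∀ m ∈ Set.Iic (l + 1),
    L.length = k * m → ∀ a : Fin m → ℝ, (∀ j, a j ∈ Set.Icc (-1 : ℝ) 1) →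
      |‖∑ j, a j • nodeDiff ψ i (listCol m j L)‖ - Q i m a| ≤ 1 / ((l : ℝ) + 1)
  have hP : ∀ l r, ∀ᶠ L : List ℕ in iterU r, P l L := by
    intro l r
    refine (eventually_all_finite (Set.finite_Iio k)).2 fun i _ => ?_
    refine (eventually_all_finite (Set.finite_Iic (l + 1))).2 fun m _ => ?_
    by_cases h : r = k * m
    · subst h
      exact (hQ i m (1 / ((l : ℝ) + 1)) (by positivity)).mono fun L hL _ => hL
    · exact (eventually_length_iterU r).mono fun L hL hL' => absurd (hL.symm.trans hL') h
  obtain ⟨M, B, hM, hB, hnB, hMB, hMS, hdiag⟩ :=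
    exists_strictMono_diagonal S hS (fun l => k * (l + 1)) P hP
  refine ⟨M, B, hM, hB, hnB, hMB, hMS, Q, ?_, ?_⟩
  · intro i hi m l _ hm s hs hl a ha
    have h1 := hdiag l (flattenPlegma s) (pairwise_flattenPlegma hs)
      (le_of_mem_flattenPlegma hs hl)
      (by rw [length_flattenPlegma]; exact Nat.mul_le_mul_left k hm) i hi m hm
      (by rw [List.length_map, length_flattenPlegma]) a ha
    have h2 : ∀ j : Fin m, nodeDiff ψ i (listCol m j ((flattenPlegma s).map M)) =
        nodeDiff ψ i (fun r => M ((s j).extend r)) := fun j =>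
      nodeDiff_congr ψ fun r hr => listCol_map_flattenPlegma s M j (lt_of_le_of_lt hr hi)
    simpa only [h2] using h1
  · intro i hi m a j₀ ha
    refine le_of_forall_pos_le_add fun ε hε => ?_
    have ha' : ∀ j, Function.update a j₀ 0 j ∈ Set.Icc (-1 : ℝ) 1 := by
      intro j
      by_cases hj : j = j₀
      · subst hj; simp
      · simpa [Function.update_of_ne hj] using ha j
    obtain ⟨L, h1, h2⟩ := ((hQ i m (ε / 3) (by positivity)).and
      (eventually_norm_suppressed_le hC hψ hi a j₀ (ε := ε / 3) (by positivity))).exists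
    have h3 := abs_le.1 (h1 a ha)
    have h4 := abs_le.1 (h1 _ ha')
    linarith [h3.2, h4.1]

/-- Spreading model estimates concern coefficients in the cube; rescaling extends their homogeneous
consequences to all coefficients. -/
theorem exists_pos_smul_mem_Icc {m : ℕ} (a : Fin m → ℝ) :
    ∃ r : ℝ, 0 < r ∧ ∀ j, (r • a) j ∈ Set.Icc (-1 : ℝ) 1 := by
  have h0 : 0 < 1 + ∑ j, |a j| := by positivity
  refine ⟨(1 + ∑ j, |a j|)⁻¹, by positivity, fun j => abs_le.1 ?_⟩
  have h1 : |a j| ≤ ∑ j, |a j| :=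
    Finset.single_le_sum (f := fun j => |a j|) (fun _ _ => abs_nonneg _) (Finset.mem_univ j)
  rw [Pi.smul_apply, smul_eq_mul, abs_mul, abs_of_pos (by positivity), inv_mul_le_iff₀ h0]
  linarith

/-- If the full branches of a tree of weak limits generate a `k`-spreading model with a lower
`ℓ¹`-estimate, then so do, along a subsequence, the differences at one of the levels. -/
theorem exists_nodeDiff_ellOne {k : ℕ} [NeZero k] {ψ : List ℕ → X} {C : ℝ}
    (hC : ∀ t, ‖ψ t‖ ≤ C)
    (hψ : ∀ t : List ℕ, t.length < k → ∀ f : StrongDual ℝ X,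
      Tendsto (fun n => f (ψ (t ++ [n]))) (hyperfilter ℕ) (𝓝 (f (ψ t))))
    (S : ℕ → Set ℕ) (hS : ∀ B, ∀ᶠ x in hyperfilter ℕ, x ∈ S B)
    {E : Type*} [AddCommGroup E] [Module ℝ E] (p : Seminorm ℝ E) (e : Module.Basis ℕ ℝ E)
    (hgen : GeneratesSpreadingModel (fun s : KSet k => ψ (List.ofFn s)) p e)
    {c : ℝ} (hc : 0 < c)
    (hlow : ∀ (m : ℕ) (a : Fin m → ℝ), c * ∑ j, |a j| ≤ p (∑ j, a j • e (j : ℕ))) :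
    ∃ M B : ℕ → ℕ, StrictMono M ∧ Monotone B ∧ (∀ n, n ≤ B n) ∧ (∀ j n, j < n → M j < B n) ∧
      (∀ n, M n ∈ S (B n)) ∧ ∃ i < k, ∃ q : Seminorm ℝ (ℕ →₀ ℝ),
        GeneratesWith (fun s : KSet k => nodeDiff ψ i (fun r => M (s.extend r))) q
          (Finsupp.basisSingleOne : Module.Basis ℕ ℝ (ℕ →₀ ℝ)) (fun l => 1 / ((l : ℝ) + 1)) ∧
        (∃ D, ∀ j, q ((Finsupp.basisSingleOne : Module.Basis ℕ ℝ (ℕ →₀ ℝ)) j) ≤ D) ∧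
        ∃ c' > 0, ∀ (m : ℕ) (a : Fin m → ℝ), c' * ∑ j, |a j| ≤
          q (∑ j, a j • (Finsupp.basisSingleOne : Module.Basis ℕ ℝ (ℕ →₀ ℝ)) (j : ℕ)) := by
  obtain ⟨M, B, hM, hB, hnB, hMB, hMS, Q, hQ, hQsupp⟩ :=
    exists_strictMono_nodeDiff_asymptotic hC hψ S hS
  refine ⟨M, B, hM, hB, hnB, hMB, hMS, ?_⟩
  let e' : ℕ → (ℕ →₀ ℝ) := fun j => (Finsupp.basisSingleOne : Module.Basis ℕ ℝ (ℕ →₀ ℝ)) j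
  have hq : ∀ i : Fin k, ∃ q : Seminorm ℝ (ℕ →₀ ℝ),
      GeneratesWith (fun s : KSet k => nodeDiff ψ i (fun r => M (s.extend r))) q
        (Finsupp.basisSingleOne : Module.Basis ℕ ℝ (ℕ →₀ ℝ)) (fun l => 1 / ((l : ℝ) + 1)) ∧
      (∃ D, ∀ j, q (e' j) ≤ D) ∧
      ((∃ c' > 0, ∀ (m : ℕ) (a : Fin m → ℝ), c' * ∑ j, |a j| ≤ q (∑ j, a j • e' (j : ℕ))) ∨
        ∀ ε > 0, ∃ N, ∀ n ≥ N, q (∑ j ∈ Finset.range n, e' j) ≤ ε * n) := by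
    intro i
    obtain ⟨q, hq1, hq2⟩ := exists_seminorm_generatesWith
      (fun s : KSet k => nodeDiff ψ i (fun r => M (s.extend r))) (2 * C)
      (fun s => norm_nodeDiff_le hC _ _) (Q i) (fun l => 1 / ((l : ℝ) + 1))
      tendsto_one_div_add_atTop_nhds_zero_nat (hQ i i.2)
    refine ⟨q, hq1, ⟨Q i 1 1, fun j => le_of_eq ?_⟩, ellOne_lower_bound_or_cesaro q e' ?_ ?_⟩
    · simpa [e'] using hq2 1 (fun _ => j) (Subsingleton.strictMono _) 1 (by simp)
    · intro m a σ hσ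
      rcases Nat.eq_zero_or_pos m with rfl | hm
      · simp
      have : NeZero m := ⟨hm.ne'⟩
      obtain ⟨r, hr, hra⟩ := exists_pos_smul_mem_Icc a
      have h1 := hq2 m σ hσ (r • a) hra
      rw [← hq2 m (fun j => (j : ℕ)) (fun _ _ h => h) (r • a) hra] at h1
      simp only [Pi.smul_apply, smul_assoc, ← Finset.smul_sum, map_smul_eq_mul] at h1
      exact mul_left_cancel₀ (norm_ne_zero_iff.2 hr.ne') h1
    · intro m a j₀
      have : NeZero m := ⟨j₀.pos.ne'⟩
      obtain ⟨r, hr, hra⟩ := exists_pos_smul_mem_Icc a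
      have h1 := hQsupp i i.2 m (r • a) j₀ hra
      have hupd : Function.update (r • a) j₀ 0 = r • Function.update a j₀ 0 := by
        rw [← Function.update_smul, smul_zero]
      have hra' : ∀ j, (r • Function.update a j₀ 0) j ∈ Set.Icc (-1 : ℝ) 1 := by
        rw [← hupd]
        intro j
        by_cases hj : j = j₀
        · subst hj; simp
        · simpa [Function.update_of_ne hj] using hra j
      rw [hupd, ← hq2 m (fun j => (j : ℕ)) (fun _ _ h => h) (r • a) hra,
        ← hq2 m (fun j => (j : ℕ)) (fun _ _ h => h) _ hra'] at h1
      simp only [Pi.smul_apply, smul_assoc, ← Finset.smul_sum, map_smul_eq_mul] at h1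
      exact le_of_mul_le_mul_left h1 (norm_pos_iff.2 hr.ne')
  choose q hqgen hqD hqalt using hq
  by_contra hcon
  have hces : ∀ i : Fin k, ∀ ε > 0, ∃ N, ∀ n ≥ N, q i (∑ j ∈ Finset.range n, e' j) ≤ ε * n :=
    fun i => (hqalt i).resolve_left fun h => hcon ⟨i, i.2, q i, hqgen i, hqD i, h⟩
  obtain ⟨δ, -, hδ, hxgen⟩ := hgen
  have hk : (0 : ℝ) < k := by exact_mod_cast NeZero.pos k
  -- With `ε = c / (4 * k)` each level contributes at most `2 * ε * n + ε * (2 * n) = c * n / k`, in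
  -- total `c * n`, half of the lower bound `2 * c * n`.
  choose N hN using fun i => hces i (c / (4 * k)) (by positivity)
  obtain ⟨n, hn1, hnN⟩ : ∃ n, 1 ≤ n ∧ ∀ i, N i ≤ n :=
    ⟨1 + ∑ i, N i, by omega, fun i =>
      (Finset.single_le_sum (f := N) (fun _ _ => Nat.zero_le _) (Finset.mem_univ i)).trans
        (by omega)⟩
  have : NeZero (n + n) := ⟨by omega⟩
  -- Coefficients of sum `0`, so that the root `ψ []` drops out.
  let a : Fin (n + n) → ℝ := fun j => if (j : ℕ) < n then 1 else -1
  have ha : ∀ j, a j ∈ Set.Icc (-1 : ℝ) 1 := by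
    intro j
    simp only [a]
    split_ifs <;> simp
  have hsplit : ∀ {V : Type} [AddCommGroup V] [Module ℝ V] (v : ℕ → V),
      ∑ j, a j • v (j : ℕ) = (2 : ℝ) • ∑ j ∈ Finset.range n, v j -
        ∑ j ∈ Finset.range (n + n), v j := by
    intro V _ _ v
    rw [← Finset.sum_range (fun j => (if j < n then (1 : ℝ) else -1) • v j),
      Finset.sum_range_add, Finset.sum_range_add, two_smul]
    have h1 : ∑ j ∈ Finset.range n, (if j < n then (1 : ℝ) else -1) • v j =
        ∑ j ∈ Finset.range n, v j := Finset.sum_congr rfl fun j hj => by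
      rw [if_pos (Finset.mem_range.1 hj), one_smul]
    have h2 : ∑ j ∈ Finset.range n, (if n + j < n then (1 : ℝ) else -1) • v (n + j) =
        - ∑ j ∈ Finset.range n, v (n + j) := by
      rw [← Finset.sum_neg_distrib]
      exact Finset.sum_congr rfl fun j hj => by rw [if_neg (by omega), neg_one_smul]
    rw [h1, h2]
    abel
  have hsum0 : ∑ j, a j = 0 := by
    have := hsplit (fun _ => (1 : ℝ))
    simp only [smul_eq_mul, mul_one, Finset.sum_const, Finset.card_range, nsmul_eq_mul] at this
    rw [this]
    push_cast
    ring
  have hsuma : ∑ j, |a j| = 2 * n := by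
    have : ∀ j, |a j| = 1 := fun j => by
      simp only [a]
      split_ifs <;> simp
    simp only [this, Finset.sum_const, Finset.card_univ, Fintype.card_fin, nsmul_eq_mul]
    push_cast
    ring
  have hqa : ∀ i, q i (∑ j, a j • e' (j : ℕ)) ≤ c / k * n := by
    intro i
    rw [hsplit e']
    refine (map_sub_le_add (q i) _ _).trans ?_
    rw [map_smul_eq_mul]
    have h1 := hN i n (hnN i)
    have h2 := hN i (n + n) ((hnN i).trans (by omega))
    have h3 : c / k * n = 4 * (c / (4 * k) * n) := by field_simp
    push_cast at h2
    rw [h3, Real.norm_of_nonneg (by norm_num)]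
    linarith
  have hmain : ∀ᶠ l : ℕ in atTop, c * n ≤ δ l + k * (1 / ((l : ℝ) + 1)) := by
    filter_upwards [eventually_ge_atTop (n + n)] with l hl
    let s : Fin (n + n) → KSet k := fun j => arithPlegma k l j
    have hs : IsPlegma s := isPlegma_arithPlegma k (fun j : Fin (n + n) => (j : ℕ))
      (fun _ _ h => h) (fun j => by have := j.2; omega)
    have hls : l ≤ s 0 0 := by
      simp only [s, arithPlegma_apply]
      nlinarith [Nat.zero_le l]
    have h1 := hxgen (n + n) l (by omega) _ (hs.map hM) (hls.trans (hM.le_apply)) a ha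
    have h2 := hlow (n + n) a
    rw [hsuma] at h2
    have h3 : ∀ j, ψ (List.ofFn ((s j).trans (OrderEmbedding.ofStrictMono M hM))) =
        ψ [] + ∑ i : Fin k, nodeDiff ψ i (fun r => M ((s j).extend r)) := by
      intro j
      rw [← initSeg_comp_extend, Fin.sum_univ_eq_sum_range
        (fun i => nodeDiff ψ i (fun r => M ((s j).extend r))) k]
      simp only [nodeDiff]
      rw [Finset.sum_range_sub (fun i => ψ (initSeg (fun r => M ((s j).extend r)) i))]
      simp [initSeg]
    have h4 : ∑ j, a j • ψ (List.ofFn ((s j).trans (OrderEmbedding.ofStrictMono M hM))) =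
        ∑ i : Fin k, ∑ j, a j • nodeDiff ψ i (fun r => M ((s j).extend r)) := by
      simp only [h3, smul_add, Finset.sum_add_distrib, ← Finset.sum_smul, hsum0, zero_smul,
        zero_add, Finset.smul_sum]
      exact Finset.sum_comm
    have h5 : ‖∑ j, a j • ψ (List.ofFn ((s j).trans (OrderEmbedding.ofStrictMono M hM)))‖ ≤
        ∑ _i : Fin k, (c / k * n + 1 / ((l : ℝ) + 1)) := by
      rw [h4]
      refine norm_sum_le_of_le _ fun i _ => ?_
      have h6 := hqgen i (n + n) l (by omega) s hs hls a ha
      linarith [(abs_le.1 h6).2, hqa i]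
    rw [Finset.sum_const, Finset.card_univ, Fintype.card_fin, nsmul_eq_mul, mul_add] at h5
    have h7 : (k : ℝ) * (c / k * n) = c * n := by field_simp
    have h8 := (abs_le.1 h1).1
    linarith
  have hlim : Tendsto (fun l : ℕ => δ l + k * (1 / ((l : ℝ) + 1))) atTop (𝓝 0) := by
    simpa using hδ.add (tendsto_one_div_add_atTop_nhds_zero_nat.const_mul (k : ℝ))
  have h0 := ge_of_tendsto hlim hmain
  have : (0 : ℝ) < n := by exact_mod_cast hn1
  nlinarith

end TreeSpreadingModels

/-! ### Equivalence with the `ℓ¹` basis through two-sided bounds. -/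

section EllOneEquivalence

variable {E : Type*} [AddCommGroup E] [Module ℝ E]

theorem norm_sum_smul_lp_single {n : ℕ} (a : Fin n → ℝ) :
    ‖∑ i, a i • (lp.single 1 (i : ℕ) (1 : ℝ) : lp (fun _ : ℕ => ℝ) 1)‖ = ∑ i, |a i| := by
  let f : ℕ → ℝ := fun i => if h : i < n then a ⟨i, h⟩ else 0
  have hf : ∀ i : Fin n, f i = a i := fun i => dif_pos i.2
  have h1 := lp.norm_sum_single (E := fun _ : ℕ => ℝ) (p := 1) (by simp) f (Finset.range n)
  simp only [ENNReal.toReal_one, Real.rpow_one, Finset.sum_range, hf, Real.norm_eq_abs] at h1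
  rw [← h1]
  congr 1
  refine Finset.sum_congr rfl fun i _ => ?_
  rw [← lp.single_smul, smul_eq_mul, mul_one]

theorem EquivalentToEllOneBasis.exists_lower_bound {p : Seminorm ℝ E} {e : ℕ → E}
    (h : EquivalentToEllOneBasis p e) :
    ∃ c > 0, ∀ (m : ℕ) (a : Fin m → ℝ), c * ∑ j, |a j| ≤ p (∑ j, a j • e (j : ℕ)) := by
  obtain ⟨c, C, hc, hcC, h⟩ := h
  have hC := hc.trans_le hcC
  refine ⟨C⁻¹, inv_pos.2 hC, fun m a => ?_⟩
  have h1 := (h m a).2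
  rw [coe_normSeminorm, norm_sum_smul_lp_single] at h1
  rwa [inv_mul_le_iff₀ hC]

theorem equivalentToEllOneBasis_of_bounds {q : Seminorm ℝ E} {e : ℕ → E} {c D : ℝ} (hc : 0 < c)
    (hlow : ∀ (m : ℕ) (a : Fin m → ℝ), c * ∑ j, |a j| ≤ q (∑ j, a j • e (j : ℕ)))
    (hD : ∀ j, q (e j) ≤ D) : EquivalentToEllOneBasis q e := by
  have hD0 : 0 ≤ D := (apply_nonneg q (e 0)).trans (hD 0)
  -- The `min` supplies the required order of the two constants; `D + 1` is positive because `0 ≤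
  -- D`.
  refine ⟨min (D + 1)⁻¹ c⁻¹, c⁻¹, by positivity, min_le_right _ _, fun n a => ?_⟩
  rw [coe_normSeminorm, norm_sum_smul_lp_single]
  refine ⟨?_, (le_inv_mul_iff₀ hc).2 (hlow n a)⟩
  have h1 : q (∑ i, a i • e (i : ℕ)) ≤ (D + 1) * ∑ i, |a i| := by
    rw [Finset.mul_sum]
    refine (Finset.le_sum_of_subadditive q (map_zero q).le (map_add_le_add q) _ _).trans (Finset.sum_le_sum fun i _ => ?_)
    rw [map_smul_eq_mul, Real.norm_eq_abs, mul_comm]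
    exact mul_le_mul_of_nonneg_right ((hD i).trans (by linarith)) (abs_nonneg _)
  calc min (D + 1)⁻¹ c⁻¹ * q (∑ i, a i • e (i : ℕ))
      ≤ (D + 1)⁻¹ * q (∑ i, a i • e (i : ℕ)) :=
        mul_le_mul_of_nonneg_right (min_le_left _ _) (apply_nonneg _ _)
    _ ≤ ∑ i, |a i| := (inv_mul_le_iff₀ (by linarith)).2 h1

end EllOneEquivalence

/-! ### Boundedness, supports and perturbation. -/

section Block

variable {X : Type*} [NormedAddCommGroup X] [NormedSpace ℝ X]

/-- One-member families are plegma, and `l = 0` puts no restriction on the first element, so the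
estimate reaches every term. -/
theorem GeneratesSpreadingModel.exists_norm_le {k : ℕ} [NeZero k] {x : KSet k → X} {E : Type*}
    [AddCommGroup E] [Module ℝ E] {p : Seminorm ℝ E} {e : Module.Basis ℕ ℝ E}
    (h : GeneratesSpreadingModel x p e) : ∃ C, ∀ s, ‖x s‖ ≤ C := by
  obtain ⟨δ, -, -, h⟩ := h
  refine ⟨p (e 0) + δ 0, fun s => ?_⟩
  have h1 := h 1 0 le_rfl (fun _ => s)
    ⟨fun i j j' hj => absurd hj (by rw [Subsingleton.elim j j']; exact lt_irrefl _),
      fun i i' hi _ _ => s.strictMono (Fin.lt_def.2 (by omega))⟩ (Nat.zero_le _) (fun _ => 1)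
    (by simp)
  simp only [Finset.univ_unique, Finset.sum_singleton, one_smul, Fin.default_eq_zero,
    Fin.val_zero] at h1
  linarith [(abs_le.1 h1).2]

theorem basisSupp_proj_sub_proj (b : SchauderBasis ℝ X) (v : X) (r r' : ℕ) :
    basisSupp b (b.proj r' v - b.proj r v) ⊆ Set.Ico (min r r') (max r r') := by
  have h : ∀ n j, b.coord j (b.proj n v) = if j < n then b.coord j v else 0 := by
    intro n j
    simp [SchauderBasis.proj_apply, b.ortho, Pi.single_apply]
  intro j hj
  simp only [basisSupp, Set.mem_ofPred_eq, map_sub, h] at hj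
  simp only [Set.mem_Ico, min_le_iff, lt_max_iff]
  split_ifs at hj with h1 h2 h2 <;> simp at hj <;> omega

/-- A perturbation which decays fast with the least element still generates the same
`k`-spreading model. -/
theorem GeneratesWith.perturb {k : ℕ} [NeZero k] {x y : KSet k → X} {E : Type*}
    [AddCommGroup E] [Module ℝ E] {p : Seminorm ℝ E} {e : Module.Basis ℕ ℝ E} {δ : ℕ → ℝ}
    (h : GeneratesWith x p e δ) {D : ℝ}
    (hxy : ∀ (s : KSet k) (l : ℕ), l ≤ s 0 → ‖y s - x s‖ ≤ D / ((l : ℝ) + 1) ^ 2) :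
    GeneratesWith y p e fun l => δ l + D * (1 / ((l : ℝ) + 1)) := by
  intro m l _ hm s hs hl a ha
  have h1 := h m l hm s hs hl a ha
  have hD : 0 ≤ D / ((l : ℝ) + 1) ^ 2 := (norm_nonneg _).trans (hxy (s 0) l hl)
  have h2 : ‖∑ j, a j • y (s j) - ∑ j, a j • x (s j)‖ ≤ D * (1 / ((l : ℝ) + 1)) := by
    rw [← Finset.sum_sub_distrib]
    have h3 : ∀ j ∈ Finset.univ, ‖a j • y (s j) - a j • x (s j)‖ ≤ D / ((l : ℝ) + 1) ^ 2 := by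
      intro j _
      rw [← smul_sub, norm_smul, Real.norm_eq_abs]
      calc |a j| * ‖y (s j) - x (s j)‖ ≤ 1 * (D / ((l : ℝ) + 1) ^ 2) :=
            mul_le_mul (abs_le.2 (ha j)) (hxy _ _ (hl.trans (hs.le_apply j 0))) (norm_nonneg _)
              zero_le_one
        _ = _ := one_mul _
    refine (norm_sum_le_of_le _ h3).trans ?_
    rw [Finset.sum_const, Finset.card_univ, Fintype.card_fin, nsmul_eq_mul]
    have hm' : (m : ℝ) ≤ (l : ℝ) + 1 := by exact_mod_cast hm
    calc (m : ℝ) * (D / ((l : ℝ) + 1) ^ 2) ≤ ((l : ℝ) + 1) * (D / ((l : ℝ) + 1) ^ 2) := by gcongr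
      _ = D * (1 / ((l : ℝ) + 1)) := by field_simp
  have h4 := abs_le.1 ((abs_norm_sub_norm_le _ _).trans h2)
  have h5 := abs_le.1 h1
  rw [abs_le]
  constructor <;> linarith

end Block

/-! ### The sliding hump argument. -/

theorem mainTheorem10 {X : Type*} [NormedAddCommGroup X] [NormedSpace ℝ X] [CompleteSpace X]
    (b : SchauderBasis ℝ X) (k : ℕ) [NeZero k]
    {E : Type*} [AddCommGroup E] [Module ℝ E] (p : Seminorm ℝ E) (e : Module.Basis ℕ ℝ E)
    (hgen : ∃ x : KSet k → X, WeaklyRelativelyCompact x ∧ GeneratesSpreadingModel x p e)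
    (hequiv : EquivalentToEllOneBasis p e) :
    ∃ (y : KSet k → X) (q : Seminorm ℝ (ℕ →₀ ℝ)),
      PlegmaBlock b y ∧
      GeneratesSpreadingModel y q (Finsupp.basisSingleOne : Module.Basis ℕ ℝ (ℕ →₀ ℝ)) ∧
      EquivalentToEllOneBasis q (Finsupp.basisSingleOne : Module.Basis ℕ ℝ (ℕ →₀ ℝ)) := by
  obtain ⟨x, hxK, hxgen⟩ := hgen
  obtain ⟨C, hxC⟩ := hxgen.exists_norm_le
  obtain ⟨ψ, hψx, hψ, hψC⟩ := exists_weak_limit_tree x hxK C hxC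
  obtain ⟨c, hc, hlow⟩ := hequiv.exists_lower_bound
  -- Quadratic decay, because up to `l + 1` errors are added at level `l`.
  let η : ℕ → ℝ := fun n => 1 / ((n : ℝ) + 1) ^ 2
  have hη0 : ∀ n, 0 < η n := fun n => by positivity
  have hη : Antitone η := fun m n h => by
    have : (m : ℝ) ≤ n := by exact_mod_cast h
    simp only [η]
    gcongr
  have hproj : ∀ B : ℕ, ∃ r₀ : ℕ, ∀ r ≥ r₀,
      ∀ t ∈ {t : List ℕ | (∀ y ∈ t, y < B) ∧ t.length ≤ k}, ∀ n ∈ Set.Iio B,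
        ‖(ψ (t ++ [n]) - ψ t) - b.proj r (ψ (t ++ [n]) - ψ t)‖ ≤ η B := by
    intro B
    refine eventually_atTop.1 ?_
    refine (eventually_all_finite (finite_bounded_lists B k)).2 fun t _ => ?_
    refine (eventually_all_finite (Set.finite_Iio B)).2 fun n _ => ?_
    have h1 := (SchauderBasis.tendsto_proj b (ψ (t ++ [n]) - ψ t)).const_sub
      (ψ (t ++ [n]) - ψ t)
    rw [sub_self] at h1
    have h2 := h1.norm
    rw [norm_zero] at h2
    exact (h2.eventually (gt_mem_nhds (hη0 B))).mono fun r hr => hr.le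
  choose r₀ hr₀ using hproj
  -- A monotone majorant of `r₀`, so that the cut-off intervals are consecutive.
  let ρ : ℕ → ℕ := fun B => ∑ B' ∈ Finset.range (B + 1), r₀ B'
  have hρ : Monotone ρ := fun B B' h =>
    Finset.sum_le_sum_of_subset (Finset.range_mono (by omega))
  have hρr : ∀ B, r₀ B ≤ ρ B := fun B =>
    Finset.single_le_sum (f := r₀) (fun _ _ => Nat.zero_le _) (Finset.self_mem_range_succ B)
  -- Next indices whose differences are almost invisible to the first `ρ B` coordinates; weak
  -- nullness makes this almost sure.
  let S : ℕ → Set ℕ := fun B => {n | ∀ t ∈ {t : List ℕ | (∀ y ∈ t, y < B) ∧ t.length ≤ k},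
    t.length < k → ‖b.proj (ρ B) (ψ (t ++ [n]) - ψ t)‖ ≤ η B}
  have hS : ∀ B, ∀ᶠ n in hyperfilter ℕ, n ∈ S B := by
    intro B
    refine (eventually_all_finite (finite_bounded_lists B k)).2 fun t _ => ?_
    by_cases ht : t.length < k
    · have h1 : Tendsto (fun n => b.proj (ρ B) (ψ (t ++ [n]) - ψ t)) (hyperfilter ℕ) (𝓝 0) := by
        simp only [SchauderBasis.proj_apply]
        rw [← Finset.sum_const_zero (s := Finset.range (ρ B))]
        refine tendsto_finsetSum _ fun i _ => ?_
        rw [← zero_smul ℝ (b i)]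
        refine Tendsto.smul_const ?_ _
        simpa using (hψ t ht (b.coord i)).sub_const (b.coord i (ψ t))
      have h2 := h1.norm
      rw [norm_zero] at h2
      exact (h2.eventually (gt_mem_nhds (hη0 B))).mono fun n hn _ => hn.le
    · exact Eventually.of_forall fun n h => absurd h ht
  have hxgen' : GeneratesSpreadingModel (fun s : KSet k => ψ (List.ofFn s)) p e := by
    simpa only [hψx] using hxgen
  obtain ⟨M, B, hM, hB, hnB, hMB, hMS, i, hi, q, hq, ⟨D, hD⟩, c', hc', hlow'⟩ :=
    exists_nodeDiff_ellOne hψC hψ S hS p e hxgen' hc hlow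
  let Y : KSet k → X := fun s => nodeDiff ψ i fun r => M (s.extend r)
  -- The head cut off is small since `M n ∈ S (B n)`, the tail by the choice of `r₀ (B (n + 1))`,
  -- where `n = s ⟨i, hi⟩`. In a plegma pair this entry increases, so the intervals are disjoint and
  -- ordered.
  let z : KSet k → X := fun s =>
    b.proj (ρ (B (s ⟨i, hi⟩ + 1))) (Y s) - b.proj (ρ (B (s ⟨i, hi⟩))) (Y s)
  have hzY : ∀ s, ‖z s - Y s‖ ≤ 2 * η (s ⟨i, hi⟩) := by
    intro s
    set n := s ⟨i, hi⟩ with hn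
    set t := initSeg (fun r => M (s.extend r)) i with ht
    have hY : Y s = ψ (t ++ [M n]) - ψ t := by
      simp only [Y, nodeDiff, initSeg_succ, s.extend_apply hi]
      rfl
    have htl : t.length = i := length_initSeg _ _
    have htB : ∀ y ∈ t, y < B n := by
      intro y hy
      obtain ⟨r, hr, rfl⟩ := List.mem_map.1 hy
      have hri : r < i := List.mem_range.1 hr
      refine hMB _ _ ?_
      rw [s.extend_apply (hri.trans hi)]
      exact s.strictMono (Fin.lt_def.2 hri)
    have h1 := hMS n t ⟨htB, by omega⟩ (by omega)
    have h2 := hr₀ (B (n + 1)) (ρ (B (n + 1))) (hρr _) t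
      ⟨fun y hy => (htB y hy).trans_le (hB (Nat.le_succ n)), by omega⟩ (M n)
      (hMB n (n + 1) (Nat.lt_succ_self n))
    rw [← hY] at h1 h2
    have h3 : η (B n) ≤ η n := hη (hnB n)
    have h4 : η (B (n + 1)) ≤ η n := hη ((Nat.le_succ n).trans (hnB (n + 1)))
    have h5 : z s - Y s =
        -((Y s - b.proj (ρ (B (n + 1))) (Y s)) + b.proj (ρ (B n)) (Y s)) := by
      simp only [z, ← hn]
      abel
    rw [h5, norm_neg]
    linarith [norm_add_le (Y s - b.proj (ρ (B (n + 1))) (Y s)) (b.proj (ρ (B n)) (Y s))]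
  refine ⟨z, q, ?_, ?_, equivalentToEllOneBasis_of_bounds hc' hlow' hD⟩
  · intro s t hst
    have hlt : s ⟨i, hi⟩ < t ⟨i, hi⟩ := hst.1 ⟨i, hi⟩ 0 1 (by simp)
    have hsupp : ∀ s : KSet k, basisSupp b (z s) ⊆
        Set.Ico (ρ (B (s ⟨i, hi⟩))) (ρ (B (s ⟨i, hi⟩ + 1))) := by
      intro s
      have h1 : ρ (B (s ⟨i, hi⟩)) ≤ ρ (B (s ⟨i, hi⟩ + 1)) := hρ (hB (Nat.le_succ _))
      have h2 := basisSupp_proj_sub_proj b (Y s) (ρ (B (s ⟨i, hi⟩))) (ρ (B (s ⟨i, hi⟩ + 1)))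
      rwa [min_eq_left h1, max_eq_right h1] at h2
    refine ⟨(Set.finite_Ico _ _).subset (hsupp s), (Set.finite_Ico _ _).subset (hsupp t), ?_⟩
    intro m hm n hn
    exact (hsupp s hm).2.trans_le ((hρ (hB hlt)).trans (hsupp t hn).1)
  · refine ⟨_, fun l => ?_, ?_, hq.perturb (D := 2) (y := z) fun s l hl => ?_⟩
    · positivity
    · simpa using tendsto_one_div_add_atTop_nhds_zero_nat.add
        ((tendsto_one_div_add_atTop_nhds_zero_nat (𝕜 := ℝ)).const_mul 2)
    · have h1 : η (s ⟨i, hi⟩) ≤ η l := hη (hl.trans (s.monotone (Fin.zero_le _)))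
      refine (hzY s).trans ?_
      rw [div_eq_mul_one_div]
      exact mul_le_mul_of_nonneg_left h1 zero_le_two
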